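/- For a metric space $\mathrm{M}=(M,d)$ let $\operatorname{dist}(\mathrm{M})=\{d(x,y) : x,y\in M\}$. A metric space $\mathrm{M}$ is \emph{homogeneous} if every isometry of a finite subspace of $\mathrm{M}$ to a subspace of $\mathrm{M}$ extends to an isometry of $\mathrm{M}$ onto $\mathrm{M}$. A \emph{Urysohn metric space} with set of distances $\mathcal{D}\subseteq\mathbb{R}_{\ge 0}$ is a homogeneous metric space $\mathrm{U}$ with $\operatorname{dist}(\mathrm{U})=\mathcal{D}$ such that every finite metric space $\mathrm{F}$ with $\operatorname{dist}(\mathrm{F})\subseteq\mathcal{D}$ embeds isometrically into $\mathrm{U}$. The set $\mathcal{D}$ is \emph{universal} if there exists a Urysohn metric space with set of distances $\mathcal{D}$. A \emph{copy} of $\mathrm{M}$ in $\mathrm{M}$ is the image of an isometric (not necessarily surjective) map $M\to M$, and $\mathrm{M}$ is \emph{indivisible} if for every colouring $\chi: M\to\{0,1\}$ there exist $i\in\{0,1\}$ and a copy $N$ of $\mathrm{M}$ in $\mathrm{M}$ such that $\chi(x)=i$ for all $x\in N$. \textbf{Theorem.} Let $\mathcal{D}\subseteq\mathbb{R}_{\ge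 0}$ be a finite universal set of numbers and let $\mathrm{M}$ be a countable Urysohn metric space with set of distances $\mathcal{D}$. Then $\mathrm{M}$ is indivisible. -/

import Mathlib

namespace UrysohnFinite

/-- The set of distances between points of a metric space (it contains `0` as soon as the space is
nonempty). -/
def distSet (M : Type*) [MetricSpace M] : Set ℝ :=
  {r | ∃ x y : M, dist x y = r}

/-- Every isometry of a finite subspace of `M` to a subspace of `M` extends to an isometry of `M`
onto `M`. -/
def IsHomogeneous (M : Type*) [MetricSpace M] : Prop :=
  ∀ (A : Set M), A.Finite → ∀ α : A → M, Isometry α →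
    ∃ g : M ≃ᵢ M, ∀ a : A, g (a : M) = α a

/-- `M` is a Urysohn metric space with set of distances `D`: it is homogeneous, its set of distances
is exactly `D`, and every finite metric space with distances in `D` embeds isometrically into `M`.
(Every finite metric space is isometric to one living in `Type`.) -/
structure IsUrysohn (D : Set ℝ) (M : Type*) [MetricSpace M] : Prop where
  distSet_eq : distSet M = D
  homogeneous : IsHomogeneous M
  embeds_finite : ∀ (F : Type) [MetricSpace F] [Finite F], distSet F ⊆ D →
    ∃ f : F → M, Isometry f

/-- A set of numbers is universal if it is the set of distances of some Urysohn metric space. -/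
def IsUniversal (D : Set ℝ) : Prop :=
  ∃ (U : Type) (_ : MetricSpace U), IsUrysohn D U

/-- A copy of `M` in `M` is the image of an isometry of `M` into `M`. -/
def IsCopy {M : Type*} [MetricSpace M] (N : Set M) : Prop :=
  ∃ f : M → M, Isometry f ∧ Set.range f = N

/-- For every colouring of the points with two colours there is a monochromatic copy of `M`
in `M`. -/
def IsIndivisible (M : Type*) [MetricSpace M] : Prop :=
  ∀ χ : M → Fin 2, ∃ (i : Fin 2) (N : Set M), IsCopy N ∧ ∀ x ∈ N, χ x = i

end UrysohnFinite

/-!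
On a finite set `D` of distances put `a ⊕ b = max {c ∈ D | c ≤ a + b}`. If `D` is the set of
distances of a Urysohn space, then triangles over `D` amalgamate, which says that `⊕` is
associative; so `D` is an ordered commutative monoid with truncated subtraction. The words over `D`
carry a `D`-valued metric, hence map isometrically into `M`, and it suffices to find a copy of `M`
among the words that is monochromatic for the induced colouring of words.

Idempotent ultrafilters on the free monoid over `D` provide words `w 0, w 1, …` containing the
letter `0` for which the product of the first `n` words, with the letters of the `k`-th factor
raised to at least `u k`, has the same colour for all `n` and `u` such that `u k = 0` for some
`k < n`. Enumerate `M` and code a point `x` by the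
product in which `u k` is the distance of `x` to the `k`-th point, ending with the factor
that belongs to `x` itself. The codes form a copy of `M`.
-/

namespace UrysohnFinite

section WordMetric

variable {A : Type*} [LinearOrder A]

/-- The distance between two elements of an ordered monoid with truncated subtraction: the least
`c` with `a ≤ c + b` and `b ≤ c + a`. -/
def gap [Sub A] (a b : A) : A := max (a - b) (b - a)

lemma gap_comm [Sub A] (a b : A) : gap a b = gap b a := max_comm _ _

variable [AddCommMonoid A] [Sub A]

lemma gap_le_iff [OrderedSub A] {a b c : A} : gap a b ≤ c ↔ a ≤ c + b ∧ b ≤ c + a := by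
  simp only [gap, max_le_iff, tsub_le_iff_right]

lemma le_add_gap [OrderedSub A] (a b : A) : a ≤ b + gap a b :=
  tsub_le_iff_left.1 (le_max_left _ _)

lemma gap_triangle [OrderedSub A] [AddLeftMono A] (a b c : A) : gap a c ≤ gap a b + gap b c :=
  max_le (tsub_le_tsub_add_tsub.trans (add_le_add (le_max_left _ _) (le_max_left _ _)))
    (add_comm (gap a b) _ ▸
      tsub_le_tsub_add_tsub.trans (add_le_add (le_max_right _ _) (le_max_right _ _)))

variable [OrderTop A]

/-- The distance of two distinct words. It is the minimum over the positions `j` of the least `c`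
with `u j + v j ≤ c` and `gap (u k) (v k) ≤ c` for all `k ≤ j`, and `⊤` if one of the words is
empty. -/
def wordBound : List A → List A → A
  | a :: u, b :: v => max (gap a b) (min (a + b) (wordBound u v))
  | _, _ => ⊤

lemma wordBound_nil_left (v : List A) : wordBound [] v = ⊤ := by simp only [wordBound]

lemma wordBound_nil_right (u : List A) : wordBound u [] = ⊤ := by cases u <;> simp only [wordBound]

lemma wordBound_comm (u v : List A) : wordBound u v = wordBound v u := by
  induction u generalizing v with
  | nil => rw [wordBound_nil_left, wordBound_nil_right]
  | cons a u ih =>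
    cases v with
    | nil => rw [wordBound_nil_left, wordBound_nil_right]
    | cons b v => simp only [wordBound, gap_comm a, add_comm a, ih v]

lemma le_wordBound {u v : List A} {d : A} (h : ∀ p ∈ u.zip v, d ≤ p.1 + p.2) :
    d ≤ wordBound u v := by
  induction u generalizing v with
  | nil => exact wordBound_nil_left v ▸ le_top
  | cons a u ih =>
    cases v with
    | nil => exact wordBound_nil_right (a :: u) ▸ le_top
    | cons b v =>
      rw [List.zip_cons_cons, List.forall_mem_cons] at h
      exact le_max_of_le_right (le_min h.1 (ih h.2))

lemma wordBound_le {u v : List A} {d : A} (hgap : ∀ p ∈ u.zip v, gap p.1 p.2 ≤ d)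
    (hadd : ∃ p ∈ u.zip v, p.1 + p.2 ≤ d) : wordBound u v ≤ d := by
  induction u generalizing v with
  | nil => simp at hadd
  | cons a u ih =>
    cases v with
    | nil => simp at hadd
    | cons b v =>
      rw [List.zip_cons_cons, List.forall_mem_cons] at hgap
      rw [List.zip_cons_cons, List.exists_mem_cons_iff] at hadd
      exact max_le hgap.1
        (hadd.elim (fun h => min_le_of_left_le h) fun h => min_le_of_right_le (ih hgap.2 h))

lemma wordBound_triangle [IsBotZeroClass A] [IsOrderedAddMonoid A] [OrderedSub A] (u v w : List A) :
    wordBound u w ≤ wordBound u v + wordBound v w := by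
  induction v generalizing u w with
  | nil => exact wordBound_nil_right u ▸ le_top.trans (le_add_of_nonneg_right zero_le)
  | cons b v ih =>
    rcases u with _ | ⟨a, u⟩
    · exact wordBound_nil_left (b :: v) ▸ le_top.trans (le_add_of_nonneg_right zero_le)
    rcases w with _ | ⟨c, w⟩
    · exact wordBound_nil_right (b :: v) ▸ le_top.trans (le_add_of_nonneg_left zero_le)
    simp only [wordBound]
    refine max_le ((gap_triangle a b c).trans (add_le_add (le_max_left _ _) (le_max_left _ _))) ?_
    rcases le_total (a + b) (wordBound u v) with hab | hab
    · calc min (a + c) (wordBound u w) ≤ a + (b + gap c b) :=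
          min_le_of_left_le (by gcongr; exact le_add_gap c b)
        _ = min (a + b) (wordBound u v) + gap b c := by rw [min_eq_left hab, gap_comm, add_assoc]
        _ ≤ _ := add_le_add (le_max_right _ _) (le_max_left _ _)
    rcases le_total (b + c) (wordBound v w) with hbc | hbc
    · calc min (a + c) (wordBound u w) ≤ (b + gap a b) + c :=
          min_le_of_left_le (by gcongr; exact le_add_gap a b)
        _ = gap a b + min (b + c) (wordBound v w) := by
          rw [min_eq_left hbc, add_comm b, add_assoc]
        _ ≤ _ := add_le_add (le_max_left _ _) (le_max_right _ _)
    · calc min (a + c) (wordBound u w) ≤ wordBound u v + wordBound v w :=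
          min_le_of_right_le (ih u w)
        _ = min (a + b) (wordBound u v) + min (b + c) (wordBound v w) := by
          rw [min_eq_right hab, min_eq_right hbc]
        _ ≤ _ := add_le_add (le_max_right _ _) (le_max_right _ _)

open Classical in
/-- The metric on words over `A`, with values in `A`, into which every countable metric space with
values in `A` will be coded. -/
noncomputable def wordDist (u v : List A) : A := if u = v then 0 else wordBound u v

lemma wordDist_self (u : List A) : wordDist u u = 0 := if_pos rfl

lemma wordDist_comm (u v : List A) : wordDist u v = wordDist v u := by
  simp only [wordDist, eq_comm (a := u), wordBound_comm u]

lemma wordDist_triangle [IsBotZeroClass A] [IsOrderedAddMonoid A] [OrderedSub A] (u v w : List A) :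
    wordDist u w ≤ wordDist u v + wordDist v w := by
  rcases eq_or_ne u w with rfl | huw
  · exact wordDist_self u ▸ zero_le
  rcases eq_or_ne u v with rfl | huv
  · rw [wordDist_self, zero_add]
  rcases eq_or_ne v w with rfl | hvw
  · rw [wordDist_self, add_zero]
  simpa only [wordDist, if_neg huw, if_neg huv, if_neg hvw] using wordBound_triangle u v w

lemma wordDist_eq {u v : List A} {d : A} (hgap : ∀ p ∈ u.zip v, gap p.1 p.2 ≤ d)
    (hadd : ∀ p ∈ u.zip v, d ≤ p.1 + p.2) (hd : (0, d) ∈ u.zip v) : wordDist u v = d := by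
  rcases eq_or_ne u v with rfl | huv
  · rw [wordDist_self]
    rw [List.zip_eq_zipWith, List.zipWith_self, List.mem_map] at hd
    obtain ⟨x, -, hx⟩ := hd
    exact (Prod.mk.inj hx).1.symm.trans (Prod.mk.inj hx).2
  · rw [wordDist, if_neg huv]
    exact (wordBound_le hgap ⟨_, hd, (zero_add d).le⟩).antisymm (le_wordBound hadd)

end WordMetric

section UltrafilterProducts

open Filter

attribute [local instance] Ultrafilter.mul Ultrafilter.semigroup

lemma ultrafilter_map_mul {S T F : Type*} [Mul S] [Mul T] [FunLike F S T] [MulHomClass F S T]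
    (f : F) (U V : Ultrafilter S) : (U * V).map f = U.map f * V.map f :=
  Ultrafilter.coe_inj.1 <| Filter.ext' fun p => by
    simp only [Ultrafilter.coe_map, eventually_map, Ultrafilter.eventually_mul, map_mul]

lemma mem_ultrafilter_mul {S : Type*} [Mul S] {U V : Ultrafilter S} {s t r : Set S} (hs : s ∈ U)
    (ht : t ∈ V) (h : ∀ x ∈ s, ∀ y ∈ t, x * y ∈ r) : r ∈ U * V :=
  (Ultrafilter.eventually_mul U V (· ∈ r)).2 <|
    mem_of_superset hs fun x hx => mem_of_superset ht fun y hy => h x hx y hy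

lemma ultrafilter_pure_one_mul {S : Type*} [MulOneClass S] (U : Ultrafilter S) :
    pure 1 * U = U :=
  Ultrafilter.coe_inj.1 <| Filter.ext' fun p => by
    simp [Ultrafilter.eventually_mul]

lemma ultrafilter_mul_pure_one {S : Type*} [MulOneClass S] (U : Ultrafilter S) :
    U * pure 1 = U :=
  Ultrafilter.coe_inj.1 <| Filter.ext' fun p => by
    simp [Ultrafilter.eventually_mul]

lemma ultrafilter_map_eq_self {S : Type*} {U : Ultrafilter S} {f : S → S} (h : ∀ᶠ x in U, f x = x) :
    U.map f = U :=
  Ultrafilter.coe_inj.1 <| (Filter.map_congr h).trans Filter.map_id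

lemma continuous_ultrafilter_map {S T : Type*} (f : S → T) :
    Continuous (Ultrafilter.map f : Ultrafilter S → Ultrafilter T) :=
  ultrafilterBasis_is_basis.continuous_iff.2 <| Set.forall_mem_range.2 fun s =>
    ultrafilter_isOpen_basic (f ⁻¹' s)

lemma exists_idempotent_absorbing {S : Type*} [Semigroup S] [TopologicalSpace S] [T2Space S]
    (hcont : ∀ r : S, Continuous (· * r)) {s : Set S} (hne : s.Nonempty) (hs : IsCompact s)
    (hmul : ∀ x ∈ s, ∀ y ∈ s, x * y ∈ s) {e : S} (he : e * e = e) (hleft : ∀ x ∈ s, e * x ∈ s)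
    (hright : ∀ x ∈ s, x * e ∈ s) : ∃ f ∈ s, f * f = f ∧ e * f = f ∧ f * e = f := by
  obtain ⟨_, ⟨x, hx, rfl⟩, hidem⟩ := exists_idempotent_in_compact_subsemigroup hcont
    ((· * e) '' s) (hne.image _) (hs.image (hcont e)) <| by
      rintro _ ⟨x, hx, rfl⟩ _ ⟨y, hy, rfl⟩
      exact ⟨x * e * y, hmul _ (hright x hx) y hy, mul_assoc _ _ _⟩
  -- left multiplication by `e` need not be continuous, so `e` is attached on that side afterwards
  refine ⟨e * (x * e), hleft _ (hright x hx), ?_, by rw [← mul_assoc, he], by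
    rw [mul_assoc, mul_assoc, he]⟩
  calc e * (x * e) * (e * (x * e)) = e * (x * (e * e) * (x * e)) := by simp only [mul_assoc]
    _ = e * (x * e) := by rw [he, hidem]

lemma exists_seq_forall_run {S C X : Type*} [Finite C] {l : Filter X} [l.NeBot]
    (step : S → C → X → S) (s₀ : S) {p : S → Prop} {q : X → Prop} (h₀ : p s₀)
    (hp : ∀ s, p s → ∀ c, ∀ᶠ x in l, p (step s c x)) (hq : ∀ᶠ x in l, q x) :
    ∃ w : ℕ → X, (∀ n, q (w n)) ∧ ∀ (u : ℕ → C) (r : ℕ → S), r 0 = s₀ →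
      (∀ n, r (n + 1) = step (r n) (u n) (w n)) → ∀ n, p (r n) := by
  -- only finitely many states can have been reached before the next choice is made
  have next (P : {P : Set S // P.Finite}) :
      ∃ x, q x ∧ ∀ s ∈ P.1, p s → ∀ c, p (step s c x) := by
    refine (hq.and ((eventually_all_finite P.2).2 fun s _ => ?_)).exists
    exact eventually_imp_distrib_left.2 fun hs => eventually_all.2 (hp s hs)
  choose x hqx hpx using next
  let reach : ℕ → {P : Set S // P.Finite} := Nat.rec ⟨{s₀}, Set.finite_singleton s₀⟩ fun _ P =>
    ⟨Set.image2 (fun s c => step s c (x P)) P.1 Set.univ, P.2.image2 _ Set.finite_univ⟩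
  refine ⟨fun n => x (reach n), fun n => hqx _, fun u r hr₀ hr n => ?_⟩
  suffices r n ∈ (reach n).1 ∧ p (r n) from this.2
  induction n with
  | zero => exact hr₀ ▸ ⟨rfl, h₀⟩
  | succ n ih =>
    exact hr n ▸ ⟨Set.mem_image2_of_mem ih.1 (Set.mem_univ _), hpx _ _ ih.1 ih.2 _⟩

theorem exists_seq_forall_prod_mem {S T C : Type*} [Monoid S] [SemilatticeInf T] [OrderTop T]
    [Finite T] [Finite C] {V : T → Ultrafilter S} (hV_top : V ⊤ = pure 1)
    (hV_inf : ∀ s t, V (s ⊓ t) = V s * V t) {U : Ultrafilter S} {f : C → S → S} {τ : C → T}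
    (hf : ∀ c, U.map (f c) = V (τ c)) {Z B : Set S} (hZ : Z ∈ U) {t₀ : T} (hB : B ∈ V t₀) :
    ∃ w : ℕ → S, (∀ n, w n ∈ Z) ∧ ∀ (u : ℕ → C) (n : ℕ),
      (Finset.range n).inf (τ ∘ u) = t₀ → ((List.range n).map fun k => f (u k) (w k)).prod ∈ B := by
  -- A partial product `p` with `inf` of its types equal to `t` is extendable if every type that
  -- completes `t` to `t₀` almost surely completes `p` to an element of `B`.
  let extendable (q : S × T) : Prop := ∀ s, q.2 ⊓ s = t₀ → ∀ᶠ y in V s, q.1 * y ∈ B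
  let step (q : S × T) (c : C) (x : S) : S × T := (q.1 * f c x, q.2 ⊓ τ c)
  have h_start : extendable (1, ⊤) := by
    rintro s hs
    rw [top_inf_eq] at hs
    simp only [hs, one_mul]
    exact hB
  have h_step (q : S × T) (hq : extendable q) (c : C) : ∀ᶠ x in U, extendable (step q c x) := by
    refine eventually_all.2 fun s => ?_
    refine eventually_imp_distrib_left.2 fun (hs : (q.2 ⊓ τ c) ⊓ s = t₀) => ?_
    have hmul : ∀ᶠ y in ↑(U.map (f c) * V s), q.1 * y ∈ B := by
      rw [hf, ← hV_inf]
      exact hq _ (by rw [← inf_assoc, hs])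
    simpa only [Ultrafilter.eventually_mul, Ultrafilter.coe_map, eventually_map, ← mul_assoc]
      using hmul
  obtain ⟨w, hw, hrun⟩ := exists_seq_forall_run step (1, ⊤) h_start h_step hZ
  refine ⟨w, hw, fun u n hn => ?_⟩
  have h_end := hrun u
    (fun n => (((List.range n).map fun k => f (u k) (w k)).prod, (Finset.range n).inf (τ ∘ u))) rfl
    (fun n => by
      simp only [step, List.prod_range_succ, Finset.range_add_one, Finset.inf_insert,
        Function.comp_apply, inf_comm]) n ⊤ (by simpa only [inf_top_eq] using hn)
  simpa [hV_top] using h_end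

variable {A : Type*} [LinearOrder A]

/-- The operation on words that raises all letters to at least `a`. -/
def raise (a : A) : FreeMonoid A →* FreeMonoid A := FreeMonoid.map (max a)

/-- The words with least letter `a`. -/
def leastLetter (a : A) : Set (FreeMonoid A) := {w | IsLeast {x | x ∈ w.toList} a}

lemma toList_raise (a : A) (w : FreeMonoid A) : (raise a w).toList = w.toList.map (max a) := rfl

lemma raise_eq_self {a : A} {w : FreeMonoid A} (h : w ∈ leastLetter a) : raise a w = w :=
  FreeMonoid.toList.injective <|
    (List.map_congr_left fun _ hx => max_eq_right (h.2 hx)).trans (List.map_id _)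

lemma leastLetter_mul_of_le {a b : A} (hab : a ≤ b) {v w : FreeMonoid A} (hv : v ∈ leastLetter a)
    (hw : w ∈ leastLetter b) : v * w ∈ leastLetter a :=
  ⟨List.mem_append_left _ hv.1, fun _ hx =>
    (List.mem_append.1 hx).elim (fun h => hv.2 h) fun h => hab.trans (hw.2 h)⟩

lemma leastLetter_mul_of_ge {a b : A} (hab : a ≤ b) {v w : FreeMonoid A} (hv : v ∈ leastLetter b)
    (hw : w ∈ leastLetter a) : v * w ∈ leastLetter a :=
  ⟨List.mem_append_right _ hw.1, fun _ hx =>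
    (List.mem_append.1 hx).elim (fun h => hab.trans (hv.2 h)) fun h => hw.2 h⟩

lemma map_raise_map_raise (a b : A) (U : Ultrafilter (FreeMonoid A)) :
    (U.map (raise b)).map (raise a) = U.map (raise (max a b)) := by
  rw [Ultrafilter.map_map]
  congr 1
  ext1 w
  apply FreeMonoid.toList.injective
  simp only [Function.comp_apply, toList_raise, List.map_map]
  exact List.map_congr_left fun x _ => (max_assoc a b x).symm

lemma map_raise_eq_self {a : A} {U : Ultrafilter (FreeMonoid A)} (h : leastLetter a ∈ U) :
    U.map (raise a) = U :=
  ultrafilter_map_eq_self (mem_of_superset h fun _ hw => raise_eq_self hw)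

/-- An ultrafilter on the words with least letter `a` that absorbs its raised images from both
sides. -/
structure IsAbsorbing (a : A) (U : Ultrafilter (FreeMonoid A)) : Prop where
  leastLetter_mem : leastLetter a ∈ U
  map_raise_mul : ∀ b, a ≤ b → U.map (raise b) * U = U
  mul_map_raise : ∀ b, a ≤ b → U * U.map (raise b) = U

lemma IsAbsorbing.mul_self {a : A} {U : Ultrafilter (FreeMonoid A)} (hU : IsAbsorbing a U) :
    U * U = U := by
  simpa only [map_raise_eq_self hU.leastLetter_mem] using hU.map_raise_mul a le_rfl

lemma IsAbsorbing.map_raise_mul_map_raise {a b c : A} {U : Ultrafilter (FreeMonoid A)}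
    (hU : IsAbsorbing a U) (hb : a ≤ b) (hc : a ≤ c) :
    U.map (raise b) * U.map (raise c) = U.map (raise (min b c)) := by
  rcases le_total b c with h | h
  · rw [min_eq_left h]
    have := congrArg (Ultrafilter.map (raise b)) (hU.mul_map_raise c hc)
    rwa [ultrafilter_map_mul, map_raise_map_raise, max_eq_right h] at this
  · rw [min_eq_right h]
    have := congrArg (Ultrafilter.map (raise c)) (hU.map_raise_mul b hb)
    rwa [ultrafilter_map_mul, map_raise_map_raise, max_eq_right h] at this

lemma exists_isAbsorbing_of_isMax {a : A} (ha : IsMax a) : ∃ U, IsAbsorbing a U := by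
  obtain ⟨U, hU, hidem⟩ := exists_idempotent_in_compact_subsemigroup
    Ultrafilter.continuous_mul_left {V : Ultrafilter (FreeMonoid A) | leastLetter a ∈ V}
    ⟨pure (FreeMonoid.of a), by simp [leastLetter, IsLeast, lowerBounds]⟩
    (ultrafilter_isClosed_basic _).isCompact fun V hV W hW =>
      mem_ultrafilter_mul hV hW fun _ hv _ hw => leastLetter_mul_of_le le_rfl hv hw
  have hraise (b : A) (hb : a ≤ b) : U.map (raise b) = U := by
    rw [← ha.eq_of_le hb, map_raise_eq_self hU]
  exact ⟨U, hU, fun b hb => by rw [hraise b hb, hidem], fun b hb => by rw [hraise b hb, hidem]⟩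

lemma exists_map_raise_eq {a b : A} (hab : a ≤ b) {U : Ultrafilter (FreeMonoid A)}
    (hU : leastLetter b ∈ U) :
    ∃ V : Ultrafilter (FreeMonoid A), leastLetter a ∈ V ∧ V.map (raise b) = U := by
  let lower : FreeMonoid A →* FreeMonoid A := FreeMonoid.map fun x => if x = b then a else x
  refine ⟨U.map lower, Ultrafilter.mem_map.2 (mem_of_superset hU fun w hw => ⟨?_, ?_⟩), ?_⟩
  · exact List.mem_map.2 ⟨b, hw.1, if_pos rfl⟩
  · rintro _ hy
    obtain ⟨x, hx, rfl⟩ := List.mem_map.1 hy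
    split_ifs
    · exact le_rfl
    · exact hab.trans (hw.2 hx)
  · rw [Ultrafilter.map_map]
    refine ultrafilter_map_eq_self (mem_of_superset hU fun w hw => ?_)
    refine FreeMonoid.toList.injective ((List.map_map ..).trans ?_)
    refine (List.map_congr_left fun x hx => ?_).trans (List.map_id _)
    have hbx : b ≤ x := hw.2 hx
    by_cases hxb : x = b <;> simp [hxb, hab, hbx]

lemma exists_isAbsorbing_of_covBy {a b : A} (hab : a ⋖ b) {U : Ultrafilter (FreeMonoid A)}
    (hU : IsAbsorbing b U) : ∃ V, IsAbsorbing a V := by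
  have hUb := map_raise_eq_self hU.leastLetter_mem
  have hmap {V W : Ultrafilter (FreeMonoid A)} (hV : V.map (raise b) = U)
      (hW : W.map (raise b) = U) : (V * W).map (raise b) = U := by
    rw [ultrafilter_map_mul, hV, hW, hU.mul_self]
  let lifts : Set (Ultrafilter (FreeMonoid A)) :=
    {V | leastLetter a ∈ V} ∩ Ultrafilter.map (raise b) ⁻¹' {U}
  have h_compact : IsCompact lifts := ((ultrafilter_isClosed_basic _).inter
    (isClosed_singleton.preimage (continuous_ultrafilter_map _))).isCompact
  have h_mul : ∀ V ∈ lifts, ∀ W ∈ lifts, V * W ∈ lifts := fun V hV W hW =>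
    ⟨mem_ultrafilter_mul hV.1 hW.1 fun _ hv _ hw => leastLetter_mul_of_le le_rfl hv hw,
      hmap hV.2 hW.2⟩
  have h_left : ∀ V ∈ lifts, U * V ∈ lifts := fun V hV =>
    ⟨mem_ultrafilter_mul hU.leastLetter_mem hV.1 fun _ hu _ hv =>
      leastLetter_mul_of_ge hab.le hu hv, hmap hUb hV.2⟩
  have h_right : ∀ V ∈ lifts, V * U ∈ lifts := fun V hV =>
    ⟨mem_ultrafilter_mul hV.1 hU.leastLetter_mem fun _ hv _ hu =>
      leastLetter_mul_of_le hab.le hv hu, hmap hV.2 hUb⟩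
  obtain ⟨V, ⟨hV, hVb⟩, hVV, hUV, hVU⟩ := exists_idempotent_absorbing
    Ultrafilter.continuous_mul_left (exists_map_raise_eq hab.le hU.leastLetter_mem) h_compact
    h_mul hU.mul_self h_left h_right
  have hraise {c : A} (hc : b ≤ c) : V.map (raise c) = U.map (raise c) := by
    simpa only [Set.mem_singleton_iff.1 hVb, max_eq_left hc] using (map_raise_map_raise c b V).symm
  refine ⟨V, hV, fun c hc => ?_, fun c hc => ?_⟩
  · rcases hc.eq_or_lt with rfl | hc
    · rw [map_raise_eq_self hV, hVV]
    · rw [hraise (hab.ge_of_gt hc), ← hUV, ← mul_assoc, hU.map_raise_mul c (hab.ge_of_gt hc)]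
  · rcases hc.eq_or_lt with rfl | hc
    · rw [map_raise_eq_self hV, hVV]
    · rw [hraise (hab.ge_of_gt hc), ← hVU, mul_assoc, hU.mul_map_raise c (hab.ge_of_gt hc)]

lemma exists_isAbsorbing [Finite A] (a : A) : ∃ U, IsAbsorbing a U := by
  induction a using WellFoundedGT.induction with
  | ind a ih =>
    by_cases ha : IsMax a
    · exact exists_isAbsorbing_of_isMax ha
    · obtain ⟨c, hac⟩ := not_isMax_iff.1 ha
      obtain ⟨b, hab, -⟩ := exists_covBy_le_of_lt hac
      obtain ⟨U, hU⟩ := ih b hab.lt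
      exact exists_isAbsorbing_of_covBy hab hU

/-- The concatenation of the first `n` words of `w`, the `k`-th one raised to `u k`. -/
def raisedProd (w : ℕ → FreeMonoid A) (u : ℕ → A) (n : ℕ) : FreeMonoid A :=
  ((List.range n).map fun k => raise (u k) (w k)).prod

theorem exists_monochromatic_raisedProd [Finite A] {o : A} (ho : IsBot o) {κ : Type*} [Finite κ]
    (χ : FreeMonoid A → κ) :
    ∃ (i : κ) (w : ℕ → FreeMonoid A), (∀ n, w n ∈ leastLetter o) ∧
      ∀ (u : ℕ → A) (n : ℕ), (∃ k < n, u k = o) → χ (raisedProd w u n) = i := by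
  obtain ⟨U, hU⟩ := exists_isAbsorbing o
  obtain ⟨i, hi⟩ := (U.map χ).eq_pure_of_finite
  have hB : χ ⁻¹' {i} ∈ U := by
    rw [← Ultrafilter.mem_map, hi]
    exact Set.mem_singleton i
  let V : WithTop A → Ultrafilter (FreeMonoid A)
    | ⊤ => pure 1
    | (a : A) => U.map (raise a)
  have hV_inf (s t : WithTop A) : V (s ⊓ t) = V s * V t := by
    induction s with
    | top => exact (congrArg V (top_inf_eq t)).trans (ultrafilter_pure_one_mul _).symm
    | coe a =>
      induction t with
      | top => exact (ultrafilter_mul_pure_one _).symm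
      | coe b => exact (hU.map_raise_mul_map_raise (ho a) (ho b)).symm
  obtain ⟨w, hw, hprod⟩ := exists_seq_forall_prod_mem (V := V) rfl hV_inf (U := U)
    (f := fun a => raise a) (τ := fun a : A => (a : WithTop A)) (fun _ => rfl) hU.leastLetter_mem
    (t₀ := o) (B := χ ⁻¹' {i}) (by
      change _ ∈ U.map (raise o)
      rwa [map_raise_eq_self hU.leastLetter_mem])
  refine ⟨i, w, hw, fun u n hu => hprod u n ?_⟩
  obtain ⟨k, hk, hko⟩ := hu
  refine le_antisymm (Finset.inf_le_of_le (Finset.mem_range.2 hk) ?_) ?_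
  · simp [hko]
  · exact Finset.le_inf fun j _ => WithTop.coe_le_coe.2 (ho _)

end UltrafilterProducts

section RaisedWords

variable {A : Type*} [LinearOrder A] (w : ℕ → FreeMonoid A)

lemma raisedProd_succ (u : ℕ → A) (n : ℕ) :
    raisedProd w u (n + 1) = raisedProd w u n * raise (u n) (w n) :=
  List.prod_range_succ _ n

lemma length_raisedProd (u v : ℕ → A) (n : ℕ) :
    (raisedProd w u n).toList.length = (raisedProd w v n).toList.length := by
  induction n with
  | zero => rfl
  | succ n ih =>
    simp only [raisedProd_succ, FreeMonoid.toList_mul, List.length_append, toList_raise,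
      List.length_map, ih]

lemma exists_raisedProd_eq_mul (u : ℕ → A) {m n : ℕ} (hmn : m ≤ n) :
    ∃ t, raisedProd w u n = raisedProd w u m * t := by
  induction n, hmn using Nat.le_induction with
  | base => exact ⟨1, (mul_one _).symm⟩
  | succ n _ ih =>
    obtain ⟨t, ht⟩ := ih
    exact ⟨t * raise (u n) (w n), by rw [raisedProd_succ, ht, mul_assoc]⟩

lemma mem_zip_raisedProd (u v : ℕ → A) {m n : ℕ} (hmn : m ≤ n) {p : A × A} :
    p ∈ (raisedProd w u m).toList.zip (raisedProd w v n).toList ↔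
      ∃ j < m, ∃ c ∈ (w j).toList, (max (u j) c, max (v j) c) = p := by
  obtain ⟨t, ht⟩ := exists_raisedProd_eq_mul w v hmn
  rw [ht, ← List.append_nil (raisedProd w u m).toList, FreeMonoid.toList_mul,
    List.zip_append (length_raisedProd w u v m), List.zip_nil_left, List.append_nil]
  clear ht hmn
  induction m with
  | zero => simp [raisedProd]
  | succ m ih =>
    rw [raisedProd_succ, raisedProd_succ, FreeMonoid.toList_mul, FreeMonoid.toList_mul,
      List.zip_append (length_raisedProd w u v m), List.mem_append, ih, toList_raise, toList_raise,
      List.zip_map', List.mem_map, Nat.exists_lt_succ_right]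

lemma wordDist_raisedProd [AddCommMonoid A] [Sub A] [OrderedSub A] [IsOrderedAddMonoid A]
    [IsBotZeroClass A] [OrderTop A] {w : ℕ → FreeMonoid A} (hw : ∀ k, 0 ∈ (w k).toList)
    {u v : ℕ → A} {e : A} (huv : ∀ j, u j ≤ e + v j) (hvu : ∀ j, v j ≤ e + u j)
    (he : ∀ j, e ≤ u j + v j) {m n : ℕ} (hmn : m < n) (hu : u m = 0) (hv : v m = e) :
    wordDist (raisedProd w u (m + 1)).toList (raisedProd w v n).toList = e := by
  refine wordDist_eq ?_ ?_ ((mem_zip_raisedProd w u v hmn).2 ⟨m, m.lt_succ_self, 0, hw m, by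
    rw [max_eq_left zero_le, max_eq_left zero_le, hu, hv]⟩)
  all_goals
    intro p hp
    obtain ⟨j, -, c, -, rfl⟩ := (mem_zip_raisedProd w u v hmn).1 hp
  · have hmax {a b : A} (h : a ≤ e + b) : max a c ≤ e + max b c :=
      max_le (h.trans (by gcongr; exact le_max_left _ _))
        ((le_max_right b c).trans (le_add_of_nonneg_left zero_le))
    exact gap_le_iff.2 ⟨hmax (huv j), hmax (hvu j)⟩
  · exact (he j).trans (add_le_add (le_max_left _ _) (le_max_left _ _))

end RaisedWords

section Extension

variable {D : Set ℝ} {M : Type*} [MetricSpace M]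

lemma IsHomogeneous.exists_isometryEquiv (hM : IsHomogeneous M) {ι : Type*} [Finite ι]
    {f g : ι → M} (hfg : ∀ i j, dist (f i) (f j) = dist (g i) (g j)) :
    ∃ φ : M ≃ᵢ M, ∀ i, φ (f i) = g i := by
  choose c hc using fun a : Set.range f => a.2
  obtain ⟨φ, hφ⟩ := hM (Set.range f) (Set.finite_range f) (g ∘ c) <|
    Isometry.of_dist_eq fun a b => by
      rw [Function.comp_apply, Function.comp_apply, ← hfg, hc, hc, Subtype.dist_eq]
  refine ⟨φ, fun i => (hφ ⟨f i, i, rfl⟩).trans (dist_eq_zero.1 ?_)⟩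
  rw [Function.comp_apply, ← hfg, hc, dist_self]

lemma IsUrysohn.dist_mem (hM : IsUrysohn D M) (x y : M) : dist x y ∈ D :=
  hM.distSet_eq ▸ ⟨x, y, rfl⟩

variable {X : Type*} [PseudoMetricSpace X]

lemma IsUrysohn.exists_dist_eq (hM : IsUrysohn D M) {ι : Type*} [Finite ι] (x : ι → X)
    (hx : ∀ i j, dist (x i) (x j) ∈ D) :
    ∃ f : ι → M, ∀ i j, dist (f i) (f j) = dist (x i) (x j) := by
  let Q := Set.range fun i => SeparationQuotient.mk (x i)
  obtain ⟨n, ⟨e⟩⟩ := Finite.exists_equiv_fin Q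
  let _ : MetricSpace (Fin n) := .induced e.symm e.symm.injective inferInstance
  obtain ⟨f, hf⟩ := hM.embeds_finite (Fin n) <| by
    rintro _ ⟨k, l, rfl⟩
    obtain ⟨i, hi⟩ := (e.symm k).2
    obtain ⟨j, hj⟩ := (e.symm l).2
    change dist (e.symm k : SeparationQuotient X) (e.symm l) ∈ D
    exact hi ▸ hj ▸ hx i j
  refine ⟨fun i => f (e ⟨_, i, rfl⟩), fun i j => (hf.dist_eq _ _).trans ?_⟩
  change dist (e.symm (e _)) (e.symm (e _)) = _
  rw [e.symm_apply_apply, e.symm_apply_apply]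
  rfl

lemma IsUrysohn.exists_extension (hM : IsUrysohn D M) (hX : ∀ x y : X, dist x y ∈ D) {ι : Type*}
    [Finite ι] {x : ι → X} {f : ι → M} (hf : ∀ i j, dist (f i) (f j) = dist (x i) (x j)) (y : X) :
    ∃ z, ∀ i, dist z (f i) = dist y (x i) := by
  obtain ⟨g, hg⟩ := hM.exists_dist_eq (fun o : Option ι => o.elim y x) fun _ _ => hX _ _
  obtain ⟨φ, hφ⟩ := hM.homogeneous.exists_isometryEquiv (f := fun i => g (some i)) (g := f)
    fun i j => (hg _ _).trans (hf i j).symm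
  exact ⟨φ (g none), fun i => by rw [← hφ, φ.dist_eq]; exact hg none (some i)⟩

/-- The finite partial isometries from `X` to `M`, given by their graphs and ordered by
extension. -/
abbrev PartialIsometry (X M : Type*) [PseudoMetricSpace X] [MetricSpace M] :=
  {s : Finset (X × M) // ∀ p ∈ s, ∀ q ∈ s, dist p.2 q.2 = dist p.1 q.1}

lemma IsUrysohn.exists_partialIsometry (hM : IsUrysohn D M) (hX : ∀ x y : X, dist x y ∈ D)
    (s : PartialIsometry X M) (y : X) : ∃ t, (∃ z, (y, z) ∈ t.1) ∧ s ≤ t := by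
  classical
  obtain ⟨z, hz⟩ := hM.exists_extension hX (x := fun p : s.1 => p.1.1) (f := fun p => p.1.2)
    (fun p q => s.2 p p.2 q q.2) y
  refine ⟨⟨insert (y, z) s.1, ?_⟩, ⟨z, Finset.mem_insert_self _ _⟩, Finset.subset_insert _ _⟩
  simp only [Finset.forall_mem_insert, dist_self, true_and]
  exact ⟨fun p hp => hz ⟨p, hp⟩, fun p hp =>
    ⟨by simpa only [dist_comm] using hz ⟨p, hp⟩, s.2 p hp⟩⟩

theorem IsUrysohn.exists_isometry_of_countable (hM : IsUrysohn D M) [Countable X]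
    (hX : ∀ x y : X, dist x y ∈ D) : ∃ Φ : X → M, Isometry Φ := by
  have := Encodable.ofCountable X
  let defined (y : X) : Order.Cofinal (PartialIsometry X M) :=
    ⟨{t | ∃ z, (y, z) ∈ t.1}, fun s => hM.exists_partialIsometry hX s y⟩
  let I := Order.idealOfCofinals (⟨∅, by simp⟩ : PartialIsometry X M) defined
  choose s hs hsI using fun y => Order.cofinal_meets_idealOfCofinals
    (⟨∅, by simp⟩ : PartialIsometry X M) defined y
  choose Φ hΦ using hs
  refine ⟨Φ, Isometry.of_dist_eq fun x y => ?_⟩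
  obtain ⟨t, -, hxt, hyt⟩ := I.directed _ (hsI x) _ (hsI y)
  exact t.2 _ (hxt (hΦ x)) _ (hyt (hΦ y))

end Extension

section DistanceMonoid

/-- Each of the three numbers is at most the sum of the other two. -/
def IsTriangle (a b c : ℝ) : Prop := a ≤ b + c ∧ b ≤ c + a ∧ c ≤ a + b

/-- The sets of distances over which two triangles with a common side can be amalgamated, the new
distance between their apices being `r`. This is the *4-values condition*. -/
class IsAmalgamationSet (D : Set ℝ) : Prop where
  zero_mem : 0 ∈ D
  nonneg : ∀ a ∈ D, 0 ≤ a
  exists_amalgam : ∀ a ∈ D, ∀ b ∈ D, ∀ c ∈ D, ∀ d ∈ D, ∀ e ∈ D, IsTriangle a b e →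
    IsTriangle e c d → ∃ r ∈ D, IsTriangle b c r ∧ IsTriangle a r d

lemma isTriangle_dist {X : Type*} [PseudoMetricSpace X] (x y z : X) :
    IsTriangle (dist x y) (dist y z) (dist x z) :=
  ⟨dist_comm y z ▸ add_comm (dist x z) _ ▸ dist_triangle x z y,
    add_comm (dist x y) _ ▸ dist_comm x y ▸ dist_triangle y x z, dist_triangle x y z⟩

lemma IsTriangle.exists_points {a b c : ℝ} (h : IsTriangle a b c) :
    ∃ x y z : ℝ × ℝ, dist x y = a ∧ dist y z = b ∧ dist x z = c := by
  obtain ⟨ha, hb, hc⟩ := h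
  refine ⟨(0, a), (a, 0), (c, b), ?_, ?_, ?_⟩ <;>
    simp only [Prod.dist_eq, Real.dist_eq, max_def, abs] <;> grind

variable {D : Set ℝ} {M : Type*} [MetricSpace M]

lemma IsUrysohn.zero_mem [Nonempty M] (hM : IsUrysohn D M) : 0 ∈ D :=
  dist_self (Classical.arbitrary M) ▸ hM.dist_mem _ _

lemma IsUrysohn.exists_triangle [Nonempty M] (hM : IsUrysohn D M) {a b c : ℝ}
    (ha : a ∈ D) (hb : b ∈ D) (hc : c ∈ D) (h : IsTriangle a b c) :
    ∃ x y z : M, dist x y = a ∧ dist y z = b ∧ dist x z = c := by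
  obtain ⟨x, y, z, rfl, rfl, rfl⟩ := h.exists_points
  obtain ⟨f, hf⟩ := hM.exists_dist_eq ![x, y, z] <| by
    simp [Fin.forall_fin_succ, hM.zero_mem, ha, hb, hc, dist_comm y x, dist_comm z]
  exact ⟨f 0, f 1, f 2, hf 0 1, hf 1 2, hf 0 2⟩

lemma IsUrysohn.isAmalgamationSet [Nonempty M] (hM : IsUrysohn D M) : IsAmalgamationSet D where
  zero_mem := hM.zero_mem
  nonneg a ha := by
    obtain ⟨x, y, rfl⟩ := hM.distSet_eq.symm ▸ ha
    exact dist_nonneg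
  exists_amalgam a ha b hb c hc d hd e he habe hecd := by
    obtain ⟨x, y, z, rfl, rfl, rfl⟩ := hM.exists_triangle ha hb he habe
    obtain ⟨x', z', w, hxz, rfl, rfl⟩ := hM.exists_triangle he hc hd hecd
    obtain ⟨φ, hφ⟩ := hM.homogeneous.exists_isometryEquiv (f := ![x', z']) (g := ![x, z]) <| by
      simp [Fin.forall_fin_two, dist_comm z' x', dist_comm z x, hxz]
    obtain ⟨hx, hz⟩ : φ x' = x ∧ φ z' = z := Fin.forall_fin_two.1 hφ
    refine ⟨dist y (φ w), hM.dist_mem _ _, ?_, ?_⟩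
    · rw [← φ.dist_eq z' w, hz]
      exact isTriangle_dist y z (φ w)
    · rw [← φ.dist_eq x' w, hx]
      exact isTriangle_dist x y (φ w)

variable [IsAmalgamationSet D]

instance : Zero D := ⟨⟨0, IsAmalgamationSet.zero_mem⟩⟩

lemma coe_zero : ((0 : D) : ℝ) = 0 := rfl

lemma coe_nonneg (a : D) : (0 : ℝ) ≤ a := IsAmalgamationSet.nonneg a a.2

instance : IsBotZeroClass D := ⟨coe_nonneg⟩

variable [Finite D]

noncomputable instance : OrderTop D where
  top := ⟨sSup D, ((Set.toFinite D).isCompact.isGreatest_sSup ⟨_, (0 : D).2⟩).1⟩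
  le_top a := ((Set.toFinite D).isCompact.isGreatest_sSup ⟨_, (0 : D).2⟩).2 a.2

lemma isGreatest_sSup_le_add (a b : D) :
    IsGreatest {c ∈ D | c ≤ a + b} (sSup {c ∈ D | c ≤ (a : ℝ) + b}) :=
  ((Set.toFinite D).sep _).isCompact.isGreatest_sSup
    ⟨a, a.2, le_add_of_nonneg_right (coe_nonneg b)⟩

lemma isLeast_sInf_le_add (a b : D) :
    IsLeast {c ∈ D | a ≤ c + b} (sInf {c ∈ D | (a : ℝ) ≤ c + b}) :=
  ((Set.toFinite D).sep _).isCompact.isLeast_sInf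
    ⟨a, a.2, le_add_of_nonneg_right (coe_nonneg b)⟩

/-- The sum of two distances is the largest distance that is at most their sum as real numbers. -/
noncomputable instance : Add D := ⟨fun a b => ⟨_, (isGreatest_sSup_le_add a b).1.1⟩⟩

/-- The difference of two distances is the least distance `c` with `a ≤ c + b`. -/
noncomputable instance : Sub D := ⟨fun a b => ⟨_, (isLeast_sInf_le_add a b).1.1⟩⟩

lemma le_add_iff {a b c : D} : c ≤ a + b ↔ (c : ℝ) ≤ a + b :=
  ⟨fun h => (Subtype.coe_le_coe.2 h).trans (isGreatest_sSup_le_add a b).1.2,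
    fun h => (isGreatest_sSup_le_add a b).2 ⟨c.2, h⟩⟩

lemma coe_add_le (a b : D) : ((a + b : D) : ℝ) ≤ a + b := le_add_iff.1 le_rfl

lemma isTriangle_add (a b : D) : IsTriangle a b (a + b : D) := by
  have ha : (a : ℝ) ≤ (a + b : D) := le_add_iff.2 (le_add_of_nonneg_right (coe_nonneg b))
  have hb : (b : ℝ) ≤ (a + b : D) := le_add_iff.2 (le_add_of_nonneg_left (coe_nonneg a))
  exact ⟨ha.trans (le_add_of_nonneg_left (coe_nonneg b)),
    hb.trans (le_add_of_nonneg_right (coe_nonneg a)), coe_add_le a b⟩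

/-- Amalgamate the triangle `a, b, a + b` with the triangle `a + b + c, c, a + b`. -/
lemma add_assoc_le (a b c : D) : a + b + c ≤ a + (b + c) := by
  obtain ⟨r, hr, ⟨-, -, hbcr⟩, -, -, hard⟩ := IsAmalgamationSet.exists_amalgam _ a.2 _ b.2 _ c.2 _
    (a + b + c).2 _ (a + b).2 (isTriangle_add a b) (isTriangle_add (a + b) c)
  have hr_le : (⟨r, hr⟩ : D) ≤ b + c := le_add_iff.2 hbcr
  exact le_add_iff.2 (hard.trans (add_le_add_right (Subtype.coe_le_coe.2 hr_le) _))

noncomputable instance : AddCommMagma D where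
  add_comm a b := eq_of_forall_le_iff fun c => by rw [le_add_iff, le_add_iff, add_comm]

noncomputable instance : AddCommMonoid D where
  zero_add a := eq_of_forall_le_iff fun c => by rw [le_add_iff, coe_zero, zero_add]; rfl
  add_zero a := eq_of_forall_le_iff fun c => by rw [le_add_iff, coe_zero, add_zero]; rfl
  add_assoc a b c := (add_assoc_le a b c).antisymm <| by
    simpa only [add_comm] using add_assoc_le c b a
  add_comm := add_comm
  nsmul := nsmulRec

instance : IsOrderedAddMonoid D where
  add_le_add_left a b h c := le_add_iff.2 ((coe_add_le a c).trans (by gcongr))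

instance : OrderedSub D where
  tsub_le_iff_right a b c := by
    have hab : IsLeast {c ∈ D | a ≤ c + b} ((a - b : D) : ℝ) := isLeast_sInf_le_add a b
    exact ⟨fun h => le_add_iff.2 (hab.1.2.trans (by gcongr)),
      fun h => hab.2 ⟨c.2, le_add_iff.1 h⟩⟩

end DistanceMonoid

section Coding

variable {D : Set ℝ} [Finite D] [IsAmalgamationSet D] {M : Type*} [MetricSpace M]

lemma IsUrysohn.exists_dist_eq_wordDist (hM : IsUrysohn D M) :
    ∃ Φ : List D → M, ∀ u v, dist (Φ u) (Φ v) = wordDist u v := by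
  let _ : PseudoMetricSpace (List D) :=
    { dist := fun u v => (wordDist u v : D)
      dist_self := fun u => congrArg Subtype.val (wordDist_self u)
      dist_comm := fun u v => congrArg Subtype.val (wordDist_comm u v)
      dist_triangle := fun u v w => le_add_iff.1 (wordDist_triangle u v w) }
  obtain ⟨Φ, hΦ⟩ := hM.exists_isometry_of_countable fun u v : List D => (wordDist u v).2
  exact ⟨Φ, hΦ.dist_eq⟩

/-- The code of `x` lists the distances of `x` to an enumeration of the space, and stops after the
position of `x` itself, where the distance is `0`. -/
lemma IsUrysohn.exists_code [Countable M] [Nonempty M] (hM : IsUrysohn D M)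
    {w : ℕ → FreeMonoid D} (hw : ∀ k, 0 ∈ (w k).toList) :
    ∃ (u : M → ℕ → D) (n : M → ℕ), (∀ x, ∃ k < n x, u x k = 0) ∧ ∀ x y,
      wordDist (raisedProd w (u x) (n x)).toList (raisedProd w (u y) (n y)).toList = dist x y := by
  obtain ⟨pt, hpt⟩ := exists_surjective_nat M
  choose s hs using hpt
  let δ (x y : M) : D := ⟨dist x y, hM.dist_mem x y⟩
  have δ_self (x : M) : δ x x = 0 := Subtype.ext (dist_self x)
  have δ_comm (x y : M) : δ x y = δ y x := Subtype.ext (dist_comm x y)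
  have δ_triangle (x y z : M) : δ x z ≤ δ x y + δ y z := le_add_iff.2 (dist_triangle x y z)
  refine ⟨fun x k => δ x (pt k), fun x => s x + 1, fun x => ⟨s x, Nat.lt_succ_self _, ?_⟩,
    fun x y => ?_⟩
  · exact (congrArg (δ x) (hs x)).trans (δ_self x)
  wlog hxy : s x ≤ s y generalizing x y
  · rw [wordDist_comm, dist_comm]
    exact this y x (le_of_not_ge hxy)
  refine congrArg Subtype.val (wordDist_raisedProd (e := δ x y) hw (fun k => δ_triangle x y (pt k))
    (fun k => δ_comm x y ▸ δ_triangle y x (pt k)) (fun k => ?_) (Nat.lt_succ_of_le hxy) ?_ ?_)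
  · rw [δ_comm y]
    exact δ_triangle x (pt k) y
  · rw [hs, δ_self]
  · rw [hs, δ_comm]

end Coding

end UrysohnFinite

open UrysohnFinite in
theorem theorem9p1_general {D : Set ℝ} (hfin : D.Finite) {M : Type*} [MetricSpace M] [Countable M]
    (hM : IsUrysohn D M) {κ : Type*} [Finite κ] [Nonempty κ] (χ : M → κ) :
    ∃ (i : κ) (N : Set M), IsCopy N ∧ ∀ x ∈ N, χ x = i := by
  rcases isEmpty_or_nonempty M with hempty | hnonempty
  · exact ⟨Classical.arbitrary κ, ∅, ⟨id, isometry_id, Set.range_eq_empty _⟩, by simp⟩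
  have := hfin.to_subtype
  have := hM.isAmalgamationSet
  obtain ⟨Φ, hΦ⟩ := hM.exists_dist_eq_wordDist
  obtain ⟨i, w, hw, hmono⟩ := exists_monochromatic_raisedProd (o := (0 : D)) isBot_zero
    fun v => χ (Φ v.toList)
  obtain ⟨u, n, hzero, hcode⟩ := hM.exists_code fun k => (hw k).1
  let embed (x : M) : M := Φ (raisedProd w (u x) (n x)).toList
  have h_embed : Isometry embed := Isometry.of_dist_eq fun x y => (hΦ _ _).trans (hcode x y)
  exact ⟨i, Set.range embed, ⟨embed, h_embed, rfl⟩,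
    Set.forall_mem_range.2 fun x => hmono (u x) (n x) (hzero x)⟩

theorem theorem9p1 (D : Set ℝ) (hfin : D.Finite) (hD : UrysohnFinite.IsUniversal D)
    (M : Type*) [MetricSpace M] [Countable M] (hM : UrysohnFinite.IsUrysohn D M) :
    UrysohnFinite.IsIndivisible M :=
  fun χ => theorem9p1_general hfin hM χ
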